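/- Let $n\ge 2$ be even and let $\{0,1\}^n_{n/2}$ be the balanced slice, i.e. the set of strings in $\{0,1\}^n$ of Hamming weight exactly $n/2$; put $n'=\binom{n}{n/2}$. Let $\mathbf u\in\{0,1\}^n_{n/2}$ have $1$-coordinates $i_1<\dots<i_{n/2}$. For a bijection $\mathcal M$ from the set $\mathbf u^{-1}\{1\}$ of $1$-coordinates of $\mathbf u$ to the set $\mathbf u^{-1}\{0\}$ of its $0$-coordinates, and for $\mathbf a\in\{0,1\}^{n/2}$, let $\Gamma(\mathbf u,(\mathcal M,\mathbf a))\in\{0,1\}^n_{n/2}$ be the string $\mathbf v$ with $v_{i_k}=u_{i_k}\oplus a_k$ and $v_{\mathcal M(i_k)}=u_{\mathcal M(i_k)}\oplus a_k$ for $k=1,\dots,n/2$. Let $W=W_n\in\mathbb R^{n'\times n'}$ be the matrix with rows and columns indexed by $\{0,1\}^n_{n/2}$ and entries $$W[\mathbf u,\mathbf v]=\Pr_{\mathcal M,\mathbf a}\big[\Gamma(\mathbf u,(\mathcal M,\mathbf a))=\mathbf v\big],$$ where $\mathcal M$ and $\mathbf a$ are independent and uniformly random. The matrix $W$ is real symmetric;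 let $\mu_1\ge\mu_2\ge\dots\ge\mu_{n'}$ be its eigenvalues, counted with multiplicity, and let $\mu(W)=\max(|\mu_2|,|\mu_{n'}|)$. Lemma ($W$ is a good expander). There is an absolute constant $C>0$ such that for every even $n\ge 2$, $$\mu(W_n)\le C\,\frac{\log n}{\sqrt n}.$$ -/

import Mathlib

namespace BalancedWalk

/-- The balanced slice: the strings in `{0,1}^n` of Hamming weight exactly `n / 2`. -/
abbrev Slice (n : ℕ) : Type :=
  {u : Fin n → Bool // (Finset.univ.filter fun i => u i = true).card = n / 2}

/-- The coordinates where `u` is `1`. -/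
abbrev Ones {n : ℕ} (u : Slice n) : Type := {i : Fin n // u.1 i = true}

/-- The coordinates where `u` is `0`. -/
abbrev Zeros {n : ℕ} (u : Slice n) : Type := {i : Fin n // u.1 i = false}

/-- Perfect matchings between the `1`-coordinates and the `0`-coordinates of `u`. -/
abbrev Matching {n : ℕ} (u : Slice n) : Type := Ones u ≃ Zeros u

theorem card_ones {n : ℕ} (u : Slice n) : Fintype.card (Ones u) = n / 2 := by
  rw [Fintype.card_subtype]; exact u.2

/-- The increasing enumeration `i_1 < i_2 < ⋯` of the `1`-coordinates of `u`. -/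
noncomputable def onesEnum {n : ℕ} (u : Slice n) : Fin (n / 2) ≃ Ones u :=
  (Fintype.orderIsoFinOfCardEq (Ones u) (card_ones u)).toEquiv

/-- The `1`-coordinate of `u` on the matching edge that contains the coordinate `j`. -/
def edgeOne {n : ℕ} (u : Slice n) (M : Matching u) (j : Fin n) : Ones u :=
  if h : u.1 j = true then ⟨j, h⟩ else M.symm ⟨j, by simpa using h⟩

/-- The string obtained from `u` by flipping both endpoints of the matching edge at the `k`-th
`1`-coordinate of `u`, for every `k` with `a k = 1`. -/
noncomputable def flipString {n : ℕ} (u : Slice n) (M : Matching u) (a : Fin (n / 2) → Bool) :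
    Fin n → Bool :=
  fun j => xor (u.1 j) (a ((onesEnum u).symm (edgeOne u M j)))

theorem flipString_balanced {n : ℕ} (u : Slice n) (M : Matching u) (a : Fin (n / 2) → Bool) :
    (Finset.univ.filter fun i => flipString u M a i = true).card = n / 2 := by
  classical
  set b : Ones u → Bool := fun i => a ((onesEnum u).symm i) with hb
  have h1 : ∀ i : Ones u, flipString u M a i.1 = !b i := by
    intro i
    simp [flipString, edgeOne, i.2, hb]
  have h0 : ∀ i : Zeros u, flipString u M a i.1 = b (M.symm i) := by
    intro i
    simp [flipString, edgeOne, i.2, hb]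
  rw [Finset.card_filter,
    ← Fintype.sum_subtype_add_sum_subtype (fun i : Fin n => u.1 i = true)]
  have hz : (∑ i : {i : Fin n // ¬ u.1 i = true}, if flipString u M a i.1 = true then 1 else 0)
      = ∑ i : Ones u, if b i = true then 1 else 0 := by
    let e : {i : Fin n // ¬ u.1 i = true} ≃ Ones u :=
      (Equiv.subtypeEquivRight (fun i => by simp)).trans M.symm
    refine Fintype.sum_equiv e _ _ ?_
    intro i
    have := h0 ⟨i.1, by simpa using i.2⟩
    simp only [this]
    rfl
  rw [hz, ← Finset.sum_add_distrib]
  refine Eq.trans ?_ (card_ones u)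
  rw [Fintype.card_eq_sum_ones]
  refine Finset.sum_congr rfl fun i _ => ?_
  rw [h1]
  cases b i <;> simp

/-- The map `Γ(u, (M, a))` from the balanced slice to itself. -/
noncomputable def Gam {n : ℕ} (u : Slice n) (M : Matching u) (a : Fin (n / 2) → Bool) : Slice n :=
  ⟨flipString u M a, flipString_balanced u M a⟩

/-- `w(u, v)`: the probability, for independent and uniformly random `M` and `a`, that
`Γ(u, (M, a)) = v`. -/
noncomputable def weight {n : ℕ} (u v : Slice n) : ℝ :=
  (Fintype.card {p : Matching u × (Fin (n / 2) → Bool) // Gam u p.1 p.2 = v} : ℝ) /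
    (Fintype.card (Matching u × (Fin (n / 2) → Bool)) : ℝ)

/-- The walk matrix `W` on the balanced slice. -/
noncomputable def walkMatrix (n : ℕ) : Matrix (Slice n) (Slice n) ℝ :=
  Matrix.of fun u v => weight u v

theorem exists_swap {n : ℕ} (u v : Slice n) :
    ∃ s : Fin n ≃ Fin n, (∀ i, u.1 (s i) = v.1 i) ∧ ∀ i, v.1 (s i) = u.1 i := by
  classical
  have key : ∀ c : Bool × Bool,
      Fintype.card {i // (v.1 i, u.1 i) = c} = Fintype.card {i // (u.1 i, v.1 i) = c} := by
    have hu := u.2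
    have hv := v.2
    have e1 := Finset.card_filter_add_card_filter_not
      (s := Finset.univ.filter fun i => u.1 i = true) (fun i => v.1 i = true)
    have e2 := Finset.card_filter_add_card_filter_not
      (s := Finset.univ.filter fun i => v.1 i = true) (fun i => u.1 i = true)
    simp only [Finset.filter_filter, Bool.not_eq_true] at e1 e2
    rintro ⟨c, d⟩
    simp only [Fintype.card_subtype, Prod.mk.injEq]
    cases c <;> cases d
    · simp only [and_comm]
    · simp only [and_comm] at *
      omega
    · simp only [and_comm] at *
      omega
    · simp only [and_comm]
  let s := Equiv.ofFiberEquiv (f := fun i => (v.1 i, u.1 i)) (g := fun i => (u.1 i, v.1 i))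
    (fun c => Fintype.equivOfCardEq (key c))
  have hs : ∀ i, (u.1 (s i), v.1 (s i)) = (v.1 i, u.1 i) := fun i =>
    Equiv.ofFiberEquiv_map (f := fun i => (v.1 i, u.1 i)) (g := fun i => (u.1 i, v.1 i)) _ i
  exact ⟨s, fun i => congrArg Prod.fst (hs i), fun i => congrArg Prod.snd (hs i)⟩

theorem weight_comm {n : ℕ} (u v : Slice n) : weight u v = weight v u := by
  classical
  obtain ⟨s, hu, hv⟩ := exists_swap u v
  let eo : Ones v ≃ Ones u := s.subtypeEquiv (fun i => by rw [hu])
  let ez : Zeros v ≃ Zeros u := s.subtypeEquiv (fun i => by rw [hu])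
  let eM : Matching v ≃ Matching u := Equiv.equivCongr eo ez
  let ek : Fin (n / 2) ≃ Fin (n / 2) := (onesEnum v).trans (eo.trans (onesEnum u).symm)
  let ea : (Fin (n / 2) → Bool) ≃ (Fin (n / 2) → Bool) := Equiv.arrowCongr ek (Equiv.refl Bool)
  let e : Matching v × (Fin (n / 2) → Bool) ≃ Matching u × (Fin (n / 2) → Bool) :=
    Equiv.prodCongr eM ea
  have hedge : ∀ (M : Matching v) (j : Fin n), edgeOne u (eM M) (s j) = eo (edgeOne v M j) := by
    intro M j
    by_cases h : v.1 j = true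
    · have h' : u.1 (s j) = true := by rw [hu, h]
      simp only [edgeOne, h, h', dite_true]
      rfl
    · have h' : ¬ u.1 (s j) = true := by rw [hu]; exact h
      rw [edgeOne, edgeOne, dif_neg h, dif_neg h']
      have : (⟨s j, by simpa using h'⟩ : Zeros u) = ez ⟨j, by simpa using h⟩ := rfl
      rw [this]
      simp [eM, Equiv.equivCongr]
  have hflip : ∀ (M : Matching v) (a : Fin (n / 2) → Bool) (j : Fin n),
      flipString u (eM M) (ea a) (s j) = flipString v M a j := by
    intro M a j
    simp only [flipString, hedge, hu]
    simp [ea, ek]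
  have hiff : ∀ p : Matching v × (Fin (n / 2) → Bool),
      Gam v p.1 p.2 = u ↔ Gam u (e p).1 (e p).2 = v := by
    rintro ⟨M, a⟩
    rw [Subtype.ext_iff, Subtype.ext_iff]
    constructor
    · intro h
      funext j
      obtain ⟨i, rfl⟩ := s.surjective j
      exact (hflip M a i).trans ((congrFun h i).trans (hv i).symm)
    · intro h
      funext i
      exact (hflip M a i).symm.trans ((congrFun h (s i)).trans (hv i))
  unfold weight
  rw [Fintype.card_congr e, Fintype.card_congr (e.subtypeEquiv (q := fun p => Gam u p.1 p.2 = v) hiff)]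

theorem walkMatrix_isHermitian (n : ℕ) : (walkMatrix n).IsHermitian := by
  ext u v
  simp [walkMatrix, weight_comm u v]

theorem one_lt_card_slice {n : ℕ} (hn : Even n) (h2 : 2 ≤ n) : 1 < Fintype.card (Slice n) := by
  classical
  obtain ⟨m, rfl⟩ := hn
  let u : Slice (m + m) := ⟨fun i => decide (i.1 < m), by
    simp only [decide_eq_true_eq]
    rw [Fin.card_filter_val_lt]; omega⟩
  let v : Slice (m + m) := ⟨fun i => decide (¬ i.1 < m), by
    simp only [decide_eq_true_eq]
    have := Finset.card_filter_add_card_filter_not (s := (Finset.univ : Finset (Fin (m + m))))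
      (fun i => i.1 < m)
    rw [Fin.card_filter_val_lt, Finset.card_univ, Fintype.card_fin] at this
    omega⟩
  refine Fintype.one_lt_card_iff.2 ⟨u, v, fun h => ?_⟩
  have := congrFun (congrArg Subtype.val h) ⟨0, by omega⟩
  simp [u, v] at this
  omega

/-- For a real symmetric matrix with eigenvalues `μ_1 ≥ μ_2 ≥ ⋯ ≥ μ_N` (counted with
multiplicity), `N ≥ 2`, the number `max (|μ_2|, |μ_N|)`.  Mathlib's `eigenvalues₀` lists the
eigenvalues in decreasing order, starting from the index `0`. -/
noncomputable def secondAbsEigenvalue {V : Type*} [Fintype V] [DecidableEq V]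
    {A : Matrix V V ℝ} (hA : A.IsHermitian) (hV : 1 < Fintype.card V) : ℝ :=
  max |hA.eigenvalues₀ ⟨1, hV⟩| |hA.eigenvalues₀ ⟨Fintype.card V - 1, by omega⟩|

end BalancedWalk

/-! ### Beta and Wallis integrals -/

namespace BalancedWalk
open Real intervalIntegral

/-! Put `m = n / 2`. If `u` and `v` differ in `2k` places, `weight u v` is `k! (m-k)! / (m! 2^m)`, a
Beta integral in `θ`. So `W` is `(m+1) / 2^m` times an average over `θ` of tensor-power kernels `∏
i, (cos θ or sin θ)` on the cube, restricted to the slice (`weight_eq_integral`). Walsh characters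
diagonalise these kernels all at once, so for `f` extended by zero to the cube, `⟨f, W f⟩` is a sum
of squared Walsh coefficients weighted by `levelIntegral` (`dotProduct_walkMatrix`). The weights are
nonnegative, so `W` is positive semidefinite and only `μ_2` matters. If `f` has sum zero, its
coefficients at `∅` and at the full set vanish, the full character being constant on the slice;
every other level contributes at most `π / √m` (`levelIntegral_le`). Courant–Fischer then gives `μ_2
≤ π / √m`, stronger than needed by a factor of order `log n`. -/

theorem integral_sin_pow_mul_cos_pow (a b : ℕ) :
    ∫ θ in (0 : ℝ)..π / 2, sin θ ^ (2 * a) * cos θ ^ (2 * b) * (2 * sin θ * cos θ) =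
      (a.factorial * b.factorial : ℝ) / (a + b + 1).factorial := by
  induction a generalizing b with
  | zero =>
    have h : ∀ x ∈ Set.uIcc (0 : ℝ) (π / 2), HasDerivAt
        (fun θ => -cos θ ^ (2 * b + 2) / (b + 1))
        (sin x ^ (2 * 0) * cos x ^ (2 * b) * (2 * sin x * cos x)) x := by
      intro x _
      have := (((hasDerivAt_cos x).pow (2 * b + 2)).neg).div_const ((b : ℝ) + 1)
      refine this.congr_deriv ?_
      simp only [show 2 * b + 2 - 1 = 2 * b + 1 by omega]
      push_cast
      field_simp
      ring
    rw [integral_eq_sub_of_hasDerivAt h (by apply Continuous.intervalIntegrable; fun_prop)]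
    have hb : ((b : ℝ) + 1) ≠ 0 := by positivity
    simp [Nat.factorial_succ]
    field_simp
  | succ a ih =>
    -- Integration by parts: the boundary terms vanish, which trades a power of `sin ^ 2` for one of
    -- `cos ^ 2`; hence `b` is generalized.
    have h : ∀ x ∈ Set.uIcc (0 : ℝ) (π / 2), HasDerivAt
        (fun θ => sin θ ^ (2 * a + 2) * cos θ ^ (2 * b + 2))
        ((a + 1) * (sin x ^ (2 * a) * cos x ^ (2 * (b + 1)) * (2 * sin x * cos x)) -
          (b + 1) * (sin x ^ (2 * (a + 1)) * cos x ^ (2 * b) * (2 * sin x * cos x))) x := by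
      intro x _
      have := ((hasDerivAt_sin x).pow (2 * a + 2)).mul ((hasDerivAt_cos x).pow (2 * b + 2))
      refine this.congr_deriv ?_
      simp only [Pi.pow_apply, show 2 * b + 2 - 1 = 2 * b + 1 by omega,
        show 2 * a + 2 - 1 = 2 * a + 1 by omega]
      push_cast
      ring
    have key := integral_eq_sub_of_hasDerivAt h (by apply Continuous.intervalIntegrable; fun_prop)
    rw [integral_sub (by apply Continuous.intervalIntegrable; fun_prop)
      (by apply Continuous.intervalIntegrable; fun_prop), integral_const_mul, integral_const_mul,
      ih (b + 1)] at key
    simp only [cos_pi_div_two, sin_zero, ne_eq, Nat.add_eq_zero_iff, OfNat.ofNat_ne_zero, and_false,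
      not_false_eq_true, zero_pow, mul_zero, zero_mul, sub_self] at key
    have hb : ((b : ℝ) + 1) ≠ 0 := by positivity
    apply mul_left_cancel₀ hb
    rw [← sub_eq_zero.1 key, show a + 1 + b + 1 = a + (b + 1) + 1 by ring,
      Nat.factorial_succ a, Nat.factorial_succ b]
    push_cast
    ring

/-- The integrated eigenvalue, at Fourier level `j`, of the kernels
`cos θ ^ (n - h) * sin θ ^ h` on the cube. -/
noncomputable def levelIntegral (n j : ℕ) : ℝ :=
  ∫ θ in (0 : ℝ)..π / 2, (cos θ + sin θ) ^ (n - j) * (cos θ - sin θ) ^ j * (2 * sin θ * cos θ)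

/-- The reflection `θ ↦ π / 2 - θ` swaps `sin` and `cos` and negates the integrand. -/
theorem levelIntegral_of_odd (n : ℕ) {j : ℕ} (hj : Odd j) : levelIntegral n j = 0 := by
  have h := integral_comp_sub_left (a := 0) (b := π / 2)
    (fun θ => (cos θ + sin θ) ^ (n - j) * (cos θ - sin θ) ^ j * (2 * sin θ * cos θ)) (π / 2)
  simp only [cos_pi_div_two_sub, sin_pi_div_two_sub, sub_self, sub_zero] at h
  have h2 : ∀ θ : ℝ, (sin θ + cos θ) ^ (n - j) * (sin θ - cos θ) ^ j * (2 * cos θ * sin θ) =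
      -((cos θ + sin θ) ^ (n - j) * (cos θ - sin θ) ^ j * (2 * sin θ * cos θ)) := by
    intro θ
    rw [← neg_sub (cos θ) (sin θ), hj.neg_pow]
    ring
  simp only [h2, integral_neg] at h
  unfold levelIntegral
  linarith

theorem levelIntegral_nonneg (n j : ℕ) : 0 ≤ levelIntegral n j := by
  rcases Nat.even_or_odd j with hj | hj
  · refine integral_nonneg (by positivity) fun θ hθ => ?_
    have hc : 0 ≤ cos θ := cos_nonneg_of_mem_Icc ⟨by linarith [hθ.1, pi_pos], hθ.2⟩
    have hs : 0 ≤ sin θ := sin_nonneg_of_nonneg_of_le_pi hθ.1 (by linarith [hθ.2, pi_pos])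
    have := hj.pow_nonneg (cos θ - sin θ)
    positivity
  · rw [levelIntegral_of_odd n hj]

theorem prod_odd_div_even_le (m : ℕ) :
    ∏ i ∈ Finset.range m, ((2 * i + 1 : ℝ) / (2 * i + 2)) ≤ 1 / √(m + 1) := by
  induction m with
  | zero => simp
  | succ m ih =>
    rw [Finset.prod_range_succ]
    refine (mul_le_mul_of_nonneg_right ih (by positivity)).trans ?_
    apply le_of_sq_le_sq _ (by positivity)
    rw [mul_pow, div_pow, div_pow, div_pow, sq_sqrt (by positivity), sq_sqrt (by positivity),
      div_mul_div_comm, div_le_div_iff₀ (by positivity) (by positivity)]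
    push_cast
    have : (0 : ℝ) ≤ m := by positivity
    nlinarith [mul_nonneg this this]

/-- Consecutive Wallis integrals differ by a factor `1 - 1 / (2m)`, which gains `1 / m` over their
size `1 / √m`. -/
theorem integral_sin_pow_sub_le {m : ℕ} (hm : 0 < m) :
    ∫ x in (0 : ℝ)..π, (sin x ^ (2 * (m - 1)) - sin x ^ (2 * m)) ≤ π / (2 * m * √m) := by
  obtain ⟨m, rfl⟩ := Nat.exists_eq_add_of_lt hm
  rw [integral_sub (by apply Continuous.intervalIntegrable; fun_prop)
      (by apply Continuous.intervalIntegrable; fun_prop)]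
  simp only [zero_add, Nat.add_sub_cancel]
  rw [integral_sin_pow_even, integral_sin_pow_even, Finset.prod_range_succ]
  have h := prod_odd_div_even_le m
  set P := ∏ i ∈ Finset.range m, ((2 * i + 1 : ℝ) / (2 * i + 2))
  have e : π * P - π * (P * ((2 * m + 1) / (2 * m + 2))) = π / (2 * (m + 1)) * P := by
    field_simp
    ring
  rw [e]
  push_cast
  refine (mul_le_mul_of_nonneg_left h (by positivity)).trans (le_of_eq ?_)
  field_simp

theorem levelIntegral_le {m j : ℕ} (h0 : 0 < j) (hj : j < 2 * m) :
    levelIntegral (2 * m) j ≤ 2 ^ m * (π / (2 * m * √m)) := by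
  rcases Nat.even_or_odd j with he | ho
  swap
  · rw [levelIntegral_of_odd _ ho]; positivity
  obtain ⟨i, rfl⟩ := he
  have hm : 0 < m := by omega
  have hi : 0 < i := by omega
  have hsum : ∀ θ, cos θ + sin θ = √2 * sin (θ + π / 4) := by
    intro θ
    rw [sin_add, cos_pi_div_four, sin_pi_div_four]
    linear_combination -(sin θ + cos θ) / 2 * (sq_sqrt (show (0 : ℝ) ≤ 2 by norm_num))
  have hdiff : ∀ θ, cos θ - sin θ = √2 * cos (θ + π / 4) := by
    intro θ
    rw [cos_add, cos_pi_div_four, sin_pi_div_four]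
    linear_combination -(cos θ - sin θ) / 2 * (sq_sqrt (show (0 : ℝ) ≤ 2 by norm_num))
  have hcont : Continuous fun x => (2 : ℝ) ^ m * (sin x ^ (2 * (m - 1)) - sin x ^ (2 * m)) := by
    fun_prop
  calc levelIntegral (2 * m) (i + i)
      ≤ ∫ θ in (0 : ℝ)..π / 2,
          2 ^ m * (sin (θ + π / 4) ^ (2 * (m - 1)) - sin (θ + π / 4) ^ (2 * m)) := by
        refine integral_mono_on (by positivity)
          (by apply Continuous.intervalIntegrable; fun_prop)
          (by apply Continuous.intervalIntegrable; fun_prop) fun θ hθ => ?_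
        have hc : 0 ≤ cos θ := cos_nonneg_of_mem_Icc ⟨by linarith [hθ.1, pi_pos], hθ.2⟩
        have hs : 0 ≤ sin θ := sin_nonneg_of_nonneg_of_le_pi hθ.1 (by linarith [hθ.2, pi_pos])
        have h1 : 2 * sin θ * cos θ ≤ 1 := by nlinarith [sin_sq_add_cos_sq θ, sq_nonneg (sin θ - cos θ)]
        have h2 : (cos θ - sin θ) ^ 2 ≤ (cos θ + sin θ) ^ 2 := by nlinarith [mul_nonneg hc hs]
        -- Level `2` dominates: all but one of the squared differences are replaced by squared sums.
        have h3 : (cos θ + sin θ) ^ (2 * m - (i + i)) * (cos θ - sin θ) ^ (i + i) ≤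
            ((cos θ + sin θ) ^ 2) ^ (m - 1) * (cos θ - sin θ) ^ 2 := by
          obtain ⟨r, rfl⟩ := Nat.exists_eq_add_of_lt hi
          obtain ⟨q, rfl⟩ : ∃ q, m = 0 + r + 1 + q := ⟨m - (r + 1), by omega⟩
          rw [show 2 * (0 + r + 1 + q) - (0 + r + 1 + (0 + r + 1)) = 2 * q by omega,
            show 0 + r + 1 + q - 1 = q + r by omega,
            show 0 + r + 1 + (0 + r + 1) = 2 * r + 2 by ring, pow_add (cos θ - sin θ), pow_mul, pow_mul,
            pow_add _ q r, mul_assoc]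
          gcongr
        have h4 : ((cos θ + sin θ) ^ 2) ^ (m - 1) * (cos θ - sin θ) ^ 2 =
            2 ^ m * (sin (θ + π / 4) ^ (2 * (m - 1)) - sin (θ + π / 4) ^ (2 * m)) := by
          rw [hsum, hdiff, mul_pow, mul_pow √2 (cos _), sq_sqrt (by norm_num), cos_sq']
          obtain ⟨q, rfl⟩ := Nat.exists_eq_add_of_lt hm
          simp only [zero_add, Nat.add_sub_cancel]
          ring
        rw [← h4]
        refine le_trans ?_ h3
        refine mul_le_of_le_one_right ?_ h1
        have : 0 ≤ (cos θ - sin θ) ^ (i + i) := Even.pow_nonneg ⟨i, rfl⟩ _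
        positivity
    _ = ∫ x in π / 4..π / 2 + π / 4, 2 ^ m * (sin x ^ (2 * (m - 1)) - sin x ^ (2 * m)) := by
        rw [integral_comp_add_right
          (fun x => (2 : ℝ) ^ m * (sin x ^ (2 * (m - 1)) - sin x ^ (2 * m))), zero_add]
    -- The integrand is nonnegative, so the interval may grow to the one in Wallis' formula.
    _ ≤ ∫ x in (0 : ℝ)..π, 2 ^ m * (sin x ^ (2 * (m - 1)) - sin x ^ (2 * m)) := by
        refine integral_mono_interval (by positivity) (by linarith [pi_pos]) (by linarith [pi_pos])
          (Filter.Eventually.of_forall fun x => ?_) (hcont.intervalIntegrable _ _)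
        refine mul_nonneg (by positivity) (sub_nonneg.2 ?_)
        rw [pow_mul, pow_mul]
        exact pow_le_pow_of_le_one (sq_nonneg _) (sin_sq_le_one x) (Nat.sub_le _ _)
    _ ≤ 2 ^ m * (π / (2 * m * √m)) := by
        rw [integral_const_mul]
        exact mul_le_mul_of_nonneg_left (integral_sin_pow_sub_le hm) (by positivity)

end BalancedWalk

/-! ### Walsh expansion of product kernels -/

namespace BalancedWalk
open Real intervalIntegral

/-- The Walsh character of the cube attached to the set `S`. -/
def walsh {n : ℕ} (S : Finset (Fin n)) (x : Fin n → Bool) : ℝ :=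
  ∏ i ∈ S, if x i = true then -1 else 1

theorem prod_ite_eq_sum_walsh {n : ℕ} (c s : ℝ) (x y : Fin n → Bool) :
    ∏ i, (if x i = y i then c else s) =
      ((2 : ℝ) ^ n)⁻¹ * ∑ S : Finset (Fin n),
        (c + s) ^ (n - S.card) * (c - s) ^ S.card * (walsh S x * walsh S y) := by
  have h : ∀ i, (if x i = y i then c else s) = 2⁻¹ *
      ((c - s) * ((if x i = true then -1 else 1) * (if y i = true then -1 else 1)) + (c + s)) := by
    intro i
    cases x i <;> cases y i <;> simp <;> ring
  simp only [h, Finset.prod_mul_distrib, Finset.prod_const, Finset.card_univ, Fintype.card_fin,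
    inv_pow]
  rw [Finset.prod_add, Finset.powerset_univ]
  congr 1
  refine Finset.sum_congr rfl fun S _ => ?_
  rw [Finset.prod_mul_distrib, Finset.prod_const, Finset.prod_const, ← Finset.compl_eq_univ_sdiff,
    Finset.card_compl, Fintype.card_fin, Finset.prod_mul_distrib]
  unfold walsh
  ring

theorem sum_walsh_mul_walsh {n : ℕ} (u v : Slice n) :
    ((2 : ℝ) ^ n)⁻¹ * ∑ S : Finset (Fin n), walsh S u.1 * walsh S v.1 = if u = v then 1 else 0 := by
  -- With `c = 1`, `s = 0` the product kernel is the identity, which yields Parseval.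
  have h := prod_ite_eq_sum_walsh 1 0 u.1 v.1
  simp only [add_zero, sub_zero, one_pow, one_mul] at h
  rw [← h]
  by_cases huv : u = v
  · simp [huv]
  · have : ∃ i, u.1 i ≠ v.1 i := by
      by_contra! hc
      exact huv (Subtype.ext (funext hc))
    obtain ⟨i, hi⟩ := this
    rw [if_neg huv]
    exact Finset.prod_eq_zero (Finset.mem_univ i) (by simp [hi])

theorem walsh_univ {n : ℕ} (u : Slice n) : walsh Finset.univ u.1 = (-1) ^ (n / 2) := by
  unfold walsh
  rw [Finset.prod_ite, Finset.prod_const, Finset.prod_const_one, u.2, mul_one]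

theorem integral_kernel {n : ℕ} (x y : Fin n → Bool) :
    ∫ θ in (0 : ℝ)..π / 2, (∏ i, (if x i = y i then cos θ else sin θ)) * (2 * sin θ * cos θ) =
      ((2 : ℝ) ^ n)⁻¹ * ∑ S : Finset (Fin n),
        levelIntegral n S.card * (walsh S x * walsh S y) := by
  simp only [prod_ite_eq_sum_walsh, levelIntegral]
  simp only [mul_assoc ((2 : ℝ) ^ n)⁻¹, Finset.sum_mul]
  rw [integral_const_mul, integral_finsetSum
    (fun S _ => by apply Continuous.intervalIntegrable; fun_prop)]
  congr 1
  refine Finset.sum_congr rfl fun S _ => ?_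
  rw [← integral_mul_const]
  congr 1
  funext θ
  ring

end BalancedWalk

/-! ### Transition probabilities by counting matchings -/

namespace BalancedWalk
open Real

/-- Composing with one compatible bijection `e` reduces the count to the stabilizer of `p` in the
permutations of `α`. -/
theorem card_equiv_comp_eq {α β : Type*} [Fintype α] [Fintype β] [DecidableEq α] [DecidableEq β]
    (p : α → Bool) (q : β → Bool)
    (h : ∀ c, Fintype.card {a // p a = c} = Fintype.card {b // q b = c}) :
    Fintype.card {M : α ≃ β // ∀ a, q (M a) = p a} =
      (Fintype.card {a // p a = true}).factorial * (Fintype.card {a // p a = false}).factorial := by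
  let e : α ≃ β := Equiv.ofFiberEquiv (f := p) (g := q) fun c => Fintype.equivOfCardEq (h c)
  have he : ∀ a, q (e a) = p a := fun a => Equiv.ofFiberEquiv_map (f := p) (g := q) _ a
  have hs := DomMulAct.stabilizer_card p
  rw [Fintype.prod_bool] at hs
  rw [← hs]
  refine Fintype.card_congr (Equiv.subtypeEquiv (Equiv.equivCongr (Equiv.refl α) e.symm) ?_)
  intro M
  rw [funext_iff]
  refine forall_congr' fun a => ?_
  have : q (M a) = p (e.symm (M a)) := by rw [← he]; simp
  simp [this, Equiv.equivCongr]

/-- The target `v` determines `a`, so computing `weight` becomes a count of matchings alone. -/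
theorem gam_eq_iff {n : ℕ} (u v : Slice n) (M : Matching u) (a : Fin (n / 2) → Bool) :
    Gam u M a = v ↔ (a = fun k => !v.1 (onesEnum u k).1) ∧
      ∀ i : Ones u, (v.1 (M i).1) = !(v.1 i.1) := by
  have h1 : ∀ i : Ones u, flipString u M a i.1 = !a ((onesEnum u).symm i) := by
    intro i
    simp [flipString, edgeOne, i.2]
  have h0 : ∀ i : Ones u, flipString u M a (M i).1 = a ((onesEnum u).symm i) := by
    intro i
    simp [flipString, edgeOne, (M i).2]
  constructor
  · rintro rfl
    refine ⟨funext fun k => ?_, fun i => ?_⟩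
    · simp [Gam, h1]
    · simp [Gam, h1, h0]
  · rintro ⟨rfl, h⟩
    refine Subtype.ext (funext fun j => ?_)
    by_cases hj : u.1 j = true
    · exact (h1 ⟨j, hj⟩).trans (by simp)
    · have := h0 (M.symm ⟨j, by simpa using hj⟩)
      have h' := h (M.symm ⟨j, by simpa using hj⟩)
      simp only [Equiv.apply_symm_apply] at this h'
      refine this.trans ?_
      simp [h']

theorem weight_eq {n : ℕ} (hn : Even n) (u v : Slice n) :
    ∃ k l : ℕ, k + l = n / 2 ∧
      weight u v = (k.factorial * l.factorial : ℝ) / (n / 2).factorial / 2 ^ (n / 2) ∧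
      ∀ c s : ℝ, ∏ i, (if u.1 i = v.1 i then c else s) = s ^ (2 * k) * c ^ (2 * l) := by
  classical
  have hu := u.2
  have hv := v.2
  have hz := Finset.card_filter_add_card_filter_not
    (s := (Finset.univ : Finset (Fin n))) (fun i => u.1 i = true)
  have e1 := Finset.card_filter_add_card_filter_not
    (s := Finset.univ.filter fun i => u.1 i = true) (fun i => v.1 i = true)
  have e2 := Finset.card_filter_add_card_filter_not
    (s := Finset.univ.filter fun i => v.1 i = true) (fun i => u.1 i = true)
  have e3 := Finset.card_filter_add_card_filter_not
    (s := Finset.univ.filter fun i => u.1 i = false) (fun i => v.1 i = true)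
  simp only [Finset.filter_filter, Bool.not_eq_true, Finset.card_univ, Fintype.card_fin] at hz e1 e2 e3
  have h2 : 2 * (n / 2) = n := Nat.two_mul_div_two_of_even hn
  set A : Bool → Bool → ℕ := fun c d =>
    (Finset.univ.filter fun i : Fin n => u.1 i = c ∧ v.1 i = d).card with hA
  have f2 : ∀ c d, (Finset.univ.filter fun i : Fin n => v.1 i = d ∧ u.1 i = c).card = A c d := by
    intro c d
    simp only [hA, and_comm]
  rw [f2, f2] at e2
  change A true true + A true false = _ at e1
  change A false true + A false false = _ at e3
  have hc : ∀ c d, Fintype.card {i : {i // u.1 i = c} // v.1 i.1 = d} = A c d := by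
    intro c d
    rw [Fintype.card_congr (Equiv.subtypeSubtypeEquivSubtypeInter _ fun i => v.1 i = d),
      Fintype.card_subtype]
  have hc' : ∀ c d, Fintype.card {i : {i // u.1 i = c} // (!v.1 i.1) = d} = A c (!d) := by
    intro c d
    rw [← hc]
    exact Fintype.card_congr (Equiv.subtypeEquivRight fun i => by cases d <;> simp)
  refine ⟨A true false, A true true, by omega, ?_, fun c s => ?_⟩
  · let e : {p : Matching u × (Fin (n / 2) → Bool) // Gam u p.1 p.2 = v} ≃
        {M : Matching u // ∀ i : Ones u, (v.1 (M i).1) = !(v.1 i.1)} :=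
      { toFun := fun p => ⟨p.1.1, ((gam_eq_iff u v _ _).1 p.2).2⟩
        invFun := fun M => ⟨(M.1, fun k => !v.1 (onesEnum u k).1), (gam_eq_iff u v _ _).2 ⟨rfl, M.2⟩⟩
        left_inv := fun p => Subtype.ext (Prod.ext rfl ((gam_eq_iff u v _ _).1 p.2).1.symm)
        right_inv := fun M => rfl }
    have hcard := card_equiv_comp_eq (fun i : Ones u => !(v.1 i.1)) (fun i : Zeros u => v.1 i.1)
      (by
        intro d
        rw [hc, hc']
        cases d
        · change A true true = A false false
          omega
        · change A true false = A false true
          omega)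
    rw [hc', hc'] at hcard
    have hE : Fintype.card (Matching u) = (n / 2).factorial := by
      have : Fintype.card (Zeros u) = n / 2 := by rw [Fintype.card_subtype]; omega
      rw [Fintype.card_equiv (Fintype.equivOfCardEq ((card_ones u).trans this.symm)), card_ones]
    unfold weight
    rw [Fintype.card_congr e, hcard, Fintype.card_prod, hE]
    simp [div_div]
  · have hcount : ∀ c d : Bool, (Finset.univ.filter fun i : Fin n => (u.1 i, v.1 i) = (c, d)).card
        = A c d := by intro c d; simp [hA]
    refine (Finset.prod_comp (fun p : Bool × Bool => if p.1 = p.2 then c else s)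
      (fun i => (u.1 i, v.1 i))).trans ?_
    rw [Finset.prod_subset (Finset.subset_univ _)]
    · rw [Fintype.prod_prod_type]
      simp only [hcount, Fintype.prod_bool]
      rw [show A false true = A true false by omega, show A false false = A true true by omega]
      simp
      ring
    · intro p _ hp
      rw [Finset.card_eq_zero.2, pow_zero]
      rw [Finset.filter_eq_empty_iff]
      rintro i _ rfl
      exact hp (Finset.mem_image_of_mem _ (Finset.mem_univ i))

theorem weight_eq_integral {n : ℕ} (hn : Even n) (u v : Slice n) :
    weight u v = ((n / 2 : ℕ) + 1) / 2 ^ (n / 2) * ∫ θ in (0 : ℝ)..π / 2,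
      (∏ i, (if u.1 i = v.1 i then cos θ else sin θ)) * (2 * sin θ * cos θ) := by
  obtain ⟨k, l, hkl, hw, hp⟩ := weight_eq hn u v
  simp only [hp]
  rw [integral_sin_pow_mul_cos_pow, hw, hkl, Nat.factorial_succ]
  push_cast
  field_simp

end BalancedWalk

/-! ### Quadratic form and second eigenvalue -/

namespace BalancedWalk
open Real

theorem weight_eq_sum_walsh {n : ℕ} (hn : Even n) (u v : Slice n) :
    weight u v = ((2 : ℝ) ^ n)⁻¹ * ∑ S : Finset (Fin n),
      ((n / 2 : ℕ) + 1) / 2 ^ (n / 2) * levelIntegral n S.card * (walsh S u.1 * walsh S v.1) := by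
  rw [weight_eq_integral hn, integral_kernel, mul_left_comm, Finset.mul_sum]
  simp only [mul_assoc]

open Matrix in
theorem dotProduct_walsh_kernel {n : ℕ} (A : Matrix (Slice n) (Slice n) ℝ)
    (c : Finset (Fin n) → ℝ)
    (hA : ∀ u v, A u v = ((2 : ℝ) ^ n)⁻¹ *
      ∑ S : Finset (Fin n), c S * (walsh S u.1 * walsh S v.1)) (f : Slice n → ℝ) :
    f ⬝ᵥ A *ᵥ f = ((2 : ℝ) ^ n)⁻¹ *
      ∑ S : Finset (Fin n), c S * (∑ u, f u * walsh S u.1) ^ 2 := by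
  simp only [dotProduct, mulVec, hA, sq, Finset.sum_mul_sum]
  simp only [Finset.mul_sum, Finset.sum_mul]
  conv_rhs => rw [Finset.sum_comm]
  conv_rhs => enter [2, u]; rw [Finset.sum_comm]
  refine Finset.sum_congr rfl fun u _ => Finset.sum_congr rfl fun v _ =>
    Finset.sum_congr rfl fun S _ => ?_
  ring

open Matrix in
theorem dotProduct_self_eq_sum_walsh {n : ℕ} (f : Slice n → ℝ) :
    f ⬝ᵥ f = ((2 : ℝ) ^ n)⁻¹ * ∑ S : Finset (Fin n), (∑ u, f u * walsh S u.1) ^ 2 := by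
  have h := dotProduct_walsh_kernel (1 : Matrix (Slice n) (Slice n) ℝ) (fun _ => 1)
    (fun u v => by simp only [one_mul, sum_walsh_mul_walsh, Matrix.one_apply]) f
  simpa using h

open Matrix in
theorem dotProduct_walkMatrix {n : ℕ} (hn : Even n) (f : Slice n → ℝ) :
    f ⬝ᵥ walkMatrix n *ᵥ f = ((2 : ℝ) ^ n)⁻¹ * ∑ S : Finset (Fin n),
      ((n / 2 : ℕ) + 1) / 2 ^ (n / 2) * levelIntegral n S.card *
        (∑ u, f u * walsh S u.1) ^ 2 :=
  dotProduct_walsh_kernel _ _ (weight_eq_sum_walsh hn) f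

open Matrix in
theorem dotProduct_walkMatrix_nonneg {n : ℕ} (hn : Even n) (f : Slice n → ℝ) :
    0 ≤ f ⬝ᵥ walkMatrix n *ᵥ f := by
  rw [dotProduct_walkMatrix hn]
  have := levelIntegral_nonneg n
  exact mul_nonneg (by positivity) (Finset.sum_nonneg fun S _ =>
    mul_nonneg (mul_nonneg (by positivity) (this _)) (sq_nonneg _))

open Matrix in
theorem dotProduct_walkMatrix_le {m : ℕ} (hm : 0 < m) (f : Slice (2 * m) → ℝ)
    (hf : ∑ u, f u = 0) :
    f ⬝ᵥ walkMatrix (2 * m) *ᵥ f ≤ π / √m * (f ⬝ᵥ f) := by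
  rw [dotProduct_walkMatrix (even_two_mul m), dotProduct_self_eq_sum_walsh,
    mul_left_comm (π / √m), Finset.mul_sum _ _ (π / √m)]
  refine mul_le_mul_of_nonneg_left (Finset.sum_le_sum fun S _ => ?_) (by positivity)
  have hdiv : 2 * m / 2 = m := by omega
  rcases S.eq_empty_or_nonempty with rfl | hS
  · simp [walsh, hf]
  by_cases hU : S = Finset.univ
  · subst hU
    simp [walsh_univ, ← Finset.sum_mul, hf]
  refine mul_le_mul_of_nonneg_right ?_ (sq_nonneg _)
  have hlt : S.card < 2 * m := by
    simpa using (Finset.card_lt_iff_ne_univ S).2 hU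
  rw [hdiv]
  refine (mul_le_mul_of_nonneg_left (levelIntegral_le hS.card_pos hlt) (by positivity)).trans ?_
  have h1 : ((m : ℝ) + 1) / (2 * m) ≤ 1 := by
    have : (1 : ℝ) ≤ m := by exact_mod_cast hm
    rw [div_le_one (by positivity)]
    linarith
  have h2 : ((m : ℝ) + 1) / 2 ^ m * (2 ^ m * (π / (2 * m * √m))) =
      ((m : ℝ) + 1) / (2 * m) * (π / √m) := by
    field_simp
  rw [h2]
  exact mul_le_of_le_one_left (by positivity) h1

open Matrix in
theorem secondAbsEigenvalue_le {V : Type*} [Fintype V] [DecidableEq V] {A : Matrix V V ℝ}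
    (hA : A.IsHermitian) (hV : 1 < Fintype.card V) {B : ℝ}
    (hpos : ∀ f : V → ℝ, 0 ≤ f ⬝ᵥ A *ᵥ f)
    (hB : ∀ f : V → ℝ, ∑ v, f v = 0 → f ⬝ᵥ A *ᵥ f ≤ B * (f ⬝ᵥ f)) :
    secondAbsEigenvalue hA hV ≤ B := by
  let e : Fin (Fintype.card V) ≃ V := Fintype.equivOfCardEq (Fintype.card_fin _)
  have he : ∀ k, hA.eigenvalues₀ k = hA.eigenvalues (e k) := fun k => by
    simp [IsHermitian.eigenvalues, e]
  let b : Fin (Fintype.card V) → V → ℝ := fun k => ⇑(hA.eigenvectorBasis (e k))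
  have hmul : ∀ k, A *ᵥ b k = hA.eigenvalues₀ k • b k := fun k => by
    rw [he]; exact hA.mulVec_eigenvectorBasis (e k)
  have hb : ∀ k l, b k ⬝ᵥ b l = if k = l then 1 else 0 := fun k l => by
    have h := orthonormal_iff_ite.1 hA.eigenvectorBasis.orthonormal (e l) (e k)
    rw [EuclideanSpace.inner_eq_star_dotProduct] at h
    simp only [star_trivial, EmbeddingLike.apply_eq_iff_eq] at h
    rw [show b k ⬝ᵥ b l = _ from h]
    simp only [eq_comm]
  have hval : ∀ k, b k ⬝ᵥ A *ᵥ b k = hA.eigenvalues₀ k := fun k => by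
    rw [hmul, dotProduct_smul, hb]; simp
  have hnn : ∀ k, 0 ≤ hA.eigenvalues₀ k := fun k => by
    rw [← hval]; exact hpos _
  set k0 : Fin (Fintype.card V) := ⟨0, by omega⟩
  set k1 : Fin (Fintype.card V) := ⟨1, hV⟩ with hk1
  have hne : k0 ≠ k1 := by simp [k0, k1]
  have h01 : hA.eigenvalues₀ k1 ≤ hA.eigenvalues₀ k0 :=
    hA.eigenvalues₀_antitone (by simp [k0, k1, Fin.le_def])
  have main : hA.eigenvalues₀ k1 ≤ B := by
    by_cases hs : ∑ v, b k1 v = 0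
    · have := hB (b k1) hs
      rwa [hval, hb, if_pos rfl, mul_one] at this
    set s := ∑ v, b k1 v with hs1
    set t := ∑ v, b k0 v with ht
    -- Courant–Fischer: this is a nonzero sum-zero vector in the span of the top two eigenvectors,
    -- so its Rayleigh quotient is at least `μ_2`.
    have h := hB (s • b k0 - t • b k1) (by
      simp only [Pi.sub_apply, Pi.smul_apply, smul_eq_mul, Finset.sum_sub_distrib,
        ← Finset.mul_sum, ← hs1, ← ht]
      ring)
    simp only [mulVec_sub, mulVec_smul, hmul, sub_dotProduct, dotProduct_sub, smul_dotProduct,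
      dotProduct_smul, hb, if_neg hne, if_neg hne.symm, if_true, smul_eq_mul] at h
    have hs2 : 0 < s ^ 2 := by positivity
    nlinarith [sq_nonneg t, mul_le_mul_of_nonneg_left h01 hs2.le]
  refine max_le ?_ ?_
  · rwa [abs_of_nonneg (hnn _)]
  · rw [abs_of_nonneg (hnn _)]
    refine le_trans (hA.eigenvalues₀_antitone ?_) main
    simp only [k1, Fin.le_def]
    omega

end BalancedWalk

theorem mainTheorem11 :
    ∃ C : ℝ, 0 < C ∧ ∀ (n : ℕ) (hn : Even n) (h2 : 2 ≤ n),
      BalancedWalk.secondAbsEigenvalue (BalancedWalk.walkMatrix_isHermitian n)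
          (BalancedWalk.one_lt_card_slice hn h2) ≤
        C * (Real.log n / Real.sqrt n) := by
  -- The factor `log n ≥ log 2 > 0.69` is spent as a constant; `10` works because `3.15 * 1.5 < 10 *
  -- 0.69`.
  refine ⟨10, by norm_num, fun n hn h2 => ?_⟩
  obtain ⟨m, rfl⟩ := even_iff_two_dvd.1 hn
  have hm : 0 < m := by omega
  refine (BalancedWalk.secondAbsEigenvalue_le _ _ (BalancedWalk.dotProduct_walkMatrix_nonneg hn)
    (BalancedWalk.dotProduct_walkMatrix_le hm)).trans ?_
  have hlog : 0.69 ≤ Real.log (2 * m : ℕ) :=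
    (by linarith [Real.log_two_gt_d9] : (0.69 : ℝ) ≤ Real.log 2).trans
      (Real.log_le_log (by norm_num) (by exact_mod_cast h2))
  have hm' : 0 < √(m : ℝ) := Real.sqrt_pos.2 (by exact_mod_cast hm)
  have hsqrt : √((2 * m : ℕ) : ℝ) ≤ 1.5 * √m := by
    push_cast
    rw [Real.sqrt_mul (by norm_num)]
    refine mul_le_mul_of_nonneg_right ?_ hm'.le
    rw [Real.sqrt_le_iff]
    norm_num
  have hn' : 0 < √((2 * m : ℕ) : ℝ) := Real.sqrt_pos.2 (by exact_mod_cast (by omega : 0 < 2 * m))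
  rw [← mul_div_assoc, div_le_div_iff₀ hm' hn']
  calc Real.pi * √((2 * m : ℕ) : ℝ) ≤ 3.15 * (1.5 * √m) := by
        gcongr
        linarith [Real.pi_lt_d2]
    _ ≤ 10 * 0.69 * √m := by nlinarith
    _ ≤ 10 * Real.log (2 * m : ℕ) * √m := by gcongr
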